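/- Let $h_m$ ($m\in\mathbb Z$) be the complete homogeneous symmetric function of degree $m$ in variables $x_1,x_2,\dots$ (so $h_0=1$ and $h_m=0$ for $m<0$). Fix an integer $k\ge 1$, let $\Lambda_{(k)}=\mathbb Z[h_1,\dots,h_k]$, and let $\operatorname{Par}^k$ be the set of partitions $\lambda$ with $\lambda_1\le k$. Write $|\lambda|$ for the size of $\lambda$ and $\ell(\lambda)$ for the number of its nonzero parts. For $m,r\in\mathbb Z$ let $k_m^{(r)}=\sum_{i=0}^{m}\binom{r+i-1}{i}h_{m-i}$, and for $\gamma\in\mathbb Z^\ell$ let $h_\gamma=h_{\gamma_1}\cdots h_{\gamma_\ell}$ and $g_\gamma=\det\bigl(k^{(i-1)}_{\gamma_i+j-i}\bigr)_{1\le i,j\le \ell}$. Let $\Delta^+_\ell=\{(i,j): 1\le i<j\le \ell\}$. The operators $R_{ij}$ and $L_j$ act on subscripts by $\gamma\mapsto\gamma+\epsilon_i-\epsilon_j$ and $\gamma\mapsto\gamma-\epsilon_j$ respectively. For $\Psi\subset\Delta^+_\ell$ and a multiset $M$ on $\{1,\dots,\ell\}$ set $$H(\Psi;\gamma)=\prod_{(i,j)\in\Delta^+_\ell\setminus\Psi}(1-R_{ij})\,h_\gamma,\qquad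 K(\Psi;M;\gamma)=\prod_{j\in M}(1-L_j)\prod_{(i,j)\in\Psi}(1-R_{ij})^{-1}g_\gamma,$$ where $(1-R_{ij})^{-1}=\sum_{n\ge 0}R_{ij}^n$ (after expansion only finitely many terms are nonzero). For $\lambda\in\operatorname{Par}^k$ choose any $\ell\ge\ell(\lambda)$ and regard $\lambda=(\lambda_1,\dots,\lambda_\ell)$ as an element of $\mathbb Z^\ell$, padding by zeros. Put $\Delta^k(\lambda)=\{(i,j)\in\Delta^+_\ell: k-\lambda_i+i<j\}$, let $M_\lambda$ be the multiset consisting of one copy of $j$ for each $(i,j)\in\Delta^{k+1}(\lambda)$, and define the $k$-Schur function $s^{(k)}_\lambda=H(\Delta^k(\lambda);\lambda)$ and the $k$-Schur Katalan function $\mathfrak g^{(k)}_\lambda=K(\Delta^k(\lambda);M_\lambda;\lambda)$. Then, for every such choice of the lengths $\ell$ (one for each $\lambda$), $\{\mathfrak g^{(k)}_\lambda\}_{\lambda\in\operatorname{Par}^k}$ is a $\mathbb Z$-basis of $\Lambda_{(k)}$, and it is unitriangularly related to the $k$-Schur basis: $\{s^{(k)}_\lambda\}_{\lambda\in\operatorname{Par}^k}$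 is a $\mathbb Z$-basis of $\Lambda_{(k)}$, and for every $\lambda\in\operatorname{Par}^k$ there are integers $a_{\lambda\mu}$ with $$\mathfrak g^{(k)}_\lambda=s^{(k)}_\lambda+\sum_{\mu\in\operatorname{Par}^k,\ |\mu|<|\lambda|}a_{\lambda\mu}\,s^{(k)}_\mu .$$ -/

import Mathlib

noncomputable section

namespace Katalan

/-- Formal power series with integer coefficients in the variables `x_1, x_2, …`
(indexed here by `ℕ`). It contains the ring of symmetric functions `ℤ[h_1, h_2, …]`. -/
abbrev Series : Type := MvPowerSeries ℕ ℤ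

/-- The complete homogeneous symmetric function `h_m`, the sum of all monomials of degree `m`,
for every integer `m`. In particular `h_0 = 1`, and `h_m = 0` for `m < 0`. -/
def h (m : ℤ) : Series := fun d : ℕ →₀ ℕ => if (d.degree : ℤ) = m then 1 else 0

/-- `Λ_(k) = ℤ[h_1, …, h_k]`. -/
def lambdaSub (k : ℕ) : Subalgebra ℤ Series :=
  Algebra.adjoin ℤ {f | ∃ m : ℕ, 1 ≤ m ∧ m ≤ k ∧ f = h m}

/-- `k_m^{(r)} = ∑_{i=0}^m binom(r+i-1, i) h_{m-i}`; the sum is empty when `m < 0`. -/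
def kInhom (r m : ℤ) : Series :=
  ∑ i ∈ Finset.range (m + 1).toNat, Ring.choose (r + i - 1) i • h (m - i)

/-- `h_γ = h_{γ_1} ⋯ h_{γ_ℓ}`. -/
def hWeight {l : ℕ} (γ : Fin l → ℤ) : Series := ∏ i, h (γ i)

/-- `g_γ = det (k^{(i-1)}_{γ_i + j - i})_{1 ≤ i, j ≤ ℓ}`. The indices in `Fin l` start at `0`,
so that the superscript `i - 1` is the value of the index. -/
def gWeight {l : ℕ} (γ : Fin l → ℤ) : Series :=
  Matrix.det (Matrix.of fun i j : Fin l =>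
    kInhom ((i : ℕ) : ℤ) (γ i + ((j : ℕ) : ℤ) - ((i : ℕ) : ℤ)))

/-- Laurent polynomials `ℤ[z_1^{±1}, …, z_ℓ^{±1}]`. -/
abbrev Laurent (l : ℕ) : Type := AddMonoidAlgebra ℤ (Fin l → ℤ)

/-- The monomial `z^γ`. -/
def mono {l : ℕ} (γ : Fin l → ℤ) : Laurent l := AddMonoidAlgebra.single γ 1

/-- `∑_γ c_γ z^γ ↦ ∑_γ c_γ F_γ`. Under this map multiplication by a Laurent polynomial is
the action of raising and lowering operators on subscripts. -/
def evalWeights {l : ℕ} (F : (Fin l → ℤ) → Series) (f : Laurent l) : Series :=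
  f.coeff.sum fun γ c => c • F γ

/-- The positive root `ε_i - ε_j` attached to `p = (i, j)`. -/
def root {l : ℕ} (p : Fin l × Fin l) : Fin l → ℤ := Pi.single p.1 1 - Pi.single p.2 1

/-- The set of (labels of) positive roots `Δ⁺_ℓ = {(i, j) | i < j}`. -/
def positiveRoots (l : ℕ) : Finset (Fin l × Fin l) :=
  Finset.univ.filter fun p => p.1 < p.2

/-- The Catalan function `H(Ψ; γ) = ∏_{(i,j) ∈ Δ⁺ ∖ Ψ} (1 - R_{ij}) h_γ`, where
`R_{ij} h_γ = h_{γ + ε_i - ε_j}`. -/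
def catalan {l : ℕ} (Ψ : Finset (Fin l × Fin l)) (γ : Fin l → ℤ) : Series :=
  evalWeights hWeight ((∏ p ∈ positiveRoots l \ Ψ, (1 - mono (root p))) * mono γ)

/-- The Katalan function
`K(Ψ; M; γ) = ∏_{j ∈ M} (1 - L_j) ∏_{(i,j) ∈ Ψ} (1 - R_{ij})⁻¹ g_γ`, where
`L_j g_γ = g_{γ - ε_j}`, `R_{ij} g_γ = g_{γ + ε_i - ε_j}` and `(1 - R_{ij})⁻¹ = ∑_{n ≥ 0} R_{ij}^n`.
Multiplying out the geometric series gives one term for each family of exponents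
`n : Ψ → ℕ`, and only finitely many of these terms are nonzero
(see `katalan_support_finite` below). -/
def katalan {l : ℕ} (Ψ : Finset (Fin l × Fin l)) (M : Multiset (Fin l)) (γ : Fin l → ℤ) :
    Series :=
  ∑ᶠ n : Ψ → ℕ, evalWeights gWeight
    (mono (∑ p : Ψ, n p • root p.1) * (M.map fun j => 1 - mono (-Pi.single j 1)).prod * mono γ)

theorem kInhom_of_neg (r : ℤ) {m : ℤ} (hm : m < 0) : kInhom r m = 0 := by
  have : (m + 1).toNat = 0 := by omega
  simp [kInhom, this]

theorem le_of_gWeight_ne_zero {l : ℕ} {β : Fin l → ℤ} (hβ : gWeight β ≠ 0) (i : Fin l) :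
    (i : ℤ) - l < β i := by
  by_contra hlt
  apply hβ
  refine Matrix.det_eq_zero_of_row_eq_zero i fun j => ?_
  have := j.2
  exact kInhom_of_neg _ (by omega)

/-- Only finitely many terms in the sum defining a Katalan function are nonzero. -/
theorem katalan_support_finite {l : ℕ} {Ψ : Finset (Fin l × Fin l)} (hΨ : Ψ ⊆ positiveRoots l)
    (M : Multiset (Fin l)) (γ : Fin l → ℤ) :
    (Function.support fun n : Ψ → ℕ => evalWeights gWeight
      (mono (∑ p : Ψ, n p • root p.1) * (M.map fun j => 1 - mono (-Pi.single j 1)).prod *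
        mono γ)).Finite := by
  set f : Laurent l := (M.map fun j => 1 - mono (-Pi.single j 1)).prod * mono γ with hf
  let T : Set (Ψ → ℕ) := ⋃ β ∈ (f.coeff.support : Set (Fin l → ℤ)),
    {n | gWeight ((∑ p : Ψ, n p • root p.1) + β) ≠ 0}
  refine Set.Finite.subset (s := T) ?_ ?_
  · refine Set.Finite.biUnion (Finset.finite_toSet _) fun β _ => ?_
    have key : ∀ n : Ψ → ℕ, gWeight ((∑ p : Ψ, n p • root p.1) + β) ≠ 0 → ∀ p : Ψ,
        (n p : ℤ) ≤ ∑ i : Fin l, ((i : ℕ) : ℤ) * (β i + l - (i : ℕ)) := by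
      intro n hn p
      have h1 : ∀ i : Fin l, 0 ≤ ((i : ℕ) : ℤ) *
          (((∑ p : Ψ, n p • root p.1) + β) i + l - (i : ℕ)) := fun i =>
        mul_nonneg (by positivity) (by have := le_of_gWeight_ne_zero hn i; omega)
      have h2 := Finset.sum_nonneg fun i (_ : i ∈ Finset.univ) => h1 i
      have h3 : ∑ i : Fin l, ((i : ℕ) : ℤ) *
          (((∑ p : Ψ, n p • root p.1) + β) i + l - (i : ℕ)) =
          (∑ q : Ψ, (n q : ℤ) * (((q.1.1 : ℕ) : ℤ) - ((q.1.2 : ℕ) : ℤ))) +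
          ∑ i : Fin l, ((i : ℕ) : ℤ) * (β i + l - (i : ℕ)) := by
        have h4 : ∀ q : Ψ, (n q : ℤ) * (((q.1.1 : ℕ) : ℤ) - ((q.1.2 : ℕ) : ℤ)) =
            ∑ i : Fin l, ((i : ℕ) : ℤ) * (n q • root q.1) i := by
          intro q
          simp [root, mul_sub, Finset.sum_sub_distrib, Pi.single_apply]
          ring
        simp_rw [h4]
        rw [Finset.sum_comm, ← Finset.sum_add_distrib]
        refine Finset.sum_congr rfl fun i _ => ?_
        rw [← Finset.mul_sum, Pi.add_apply, Finset.sum_apply]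
        ring
      have hroot : ∀ q : Ψ, ((q.1.1 : ℕ) : ℤ) - ((q.1.2 : ℕ) : ℤ) ≤ -1 := by
        intro q
        have := hΨ q.2
        simp only [positiveRoots, Finset.mem_filter, Finset.mem_univ, true_and] at this
        have : (q.1.1 : ℕ) < q.1.2 := this
        omega
      have h5 : (∑ q : Ψ, (n q : ℤ) * (((q.1.1 : ℕ) : ℤ) - ((q.1.2 : ℕ) : ℤ))) ≤
          ∑ q : Ψ, -(n q : ℤ) := by
        refine Finset.sum_le_sum fun q _ => ?_
        have := hroot q
        nlinarith [Int.natCast_nonneg (n q)]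
      have h6 : (n p : ℤ) ≤ ∑ q : Ψ, (n q : ℤ) :=
        Finset.single_le_sum (f := fun q : Ψ => (n q : ℤ)) (fun q _ => by positivity)
          (Finset.mem_univ p)
      rw [Finset.sum_neg_distrib] at h5
      linarith
    refine Set.Finite.subset (Set.finite_Iic (fun _ : Ψ =>
      (∑ i : Fin l, ((i : ℕ) : ℤ) * (β i + l - (i : ℕ))).toNat)) ?_
    intro n hn p
    have := key n hn p
    show n p ≤ (∑ i : Fin l, ((i : ℕ) : ℤ) * (β i + l - (i : ℕ))).toNat
    omega
  · intro n hn
    by_contra hT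
    apply hn
    simp only [T, Set.mem_iUnion, Set.mem_ofPred_eq, not_exists, not_not] at hT
    show evalWeights gWeight _ = 0
    rw [mul_assoc, ← hf, evalWeights, Finsupp.sum]
    refine Finset.sum_eq_zero fun δ hδ => ?_
    have hδ' : (mono (∑ p : Ψ, n p • root p.1) * f).coeff δ =
        f.coeff (-(∑ p : Ψ, n p • root p.1) + δ) := by
      simp [mono, AddMonoidAlgebra.coeff_single_mul_apply]
    have := hT (-(∑ p : Ψ, n p • root p.1) + δ) (by
      rw [Finset.mem_coe, Finsupp.mem_support_iff, ← hδ']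
      exact Finsupp.mem_support_iff.1 hδ)
    rw [add_neg_cancel_left] at this
    rw [this, smul_zero]

/-- `Δ^k(μ) = {(i, j) ∈ Δ⁺_ℓ | k - μ_i + i < j}`. -/
def kRootIdeal {l : ℕ} (k : ℕ) (μ : Fin l → ℤ) : Finset (Fin l × Fin l) :=
  (positiveRoots l).filter fun p => (k : ℤ) - μ p.1 + ((p.1 : ℕ) : ℤ) < ((p.2 : ℕ) : ℤ)

/-- The multiset `L(𝓛) = ⨆_{(i, j) ∈ 𝓛} {j}`. -/
def columnMultiset {l : ℕ} (S : Finset (Fin l × Fin l)) : Multiset (Fin l) :=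
  S.val.map Prod.snd

/-- The `k`-Schur function `s_μ^{(k)} = H(Δ^k(μ); μ)`. -/
def kSchur {l : ℕ} (k : ℕ) (μ : Fin l → ℤ) : Series := catalan (kRootIdeal k μ) μ

/-- The `k`-Schur Katalan function `𝔤_μ^{(k)} = K(Δ^k(μ); Δ^{k+1}(μ); μ)`. -/
def kSchurKatalan {l : ℕ} (k : ℕ) (μ : Fin l → ℤ) : Series :=
  katalan (kRootIdeal k μ) (columnMultiset (kRootIdeal (k + 1) μ)) μ

/-- `Par^k`, the set of partitions `μ` with `μ_1 ≤ k`. -/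
abbrev BoundedPartition (k : ℕ) : Type := {μ : YoungDiagram // μ.rowLen 0 ≤ k}

/-- The partition `μ` as the weight `(μ_1, …, μ_l)`. -/
def weight (μ : YoungDiagram) (l : ℕ) : Fin l → ℤ := fun i => (μ.rowLen i : ℤ)

end Katalan

end

/-!
Write `h_μ = ∏ h_{μ_i}` for `μ ∈ Par^k`. These products form a `ℤ`-basis of `Λ_(k)`: they span by
definition, and they are linearly independent because `h_1, …, h_k` are algebraically independent
already in `k` variables (`algebraicIndependent_h`). The latter follows from the fundamental theorem
on elementary symmetric polynomials and the relation `∑ (-1)^i e_i h_{m-i} = 0`, which makes the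
substitution `e_i ↦ h_i` an involution of the polynomial ring.

Both families of the theorem are compared with this basis by triangularity. Let `λ_1 ≤ k` and
`Ψ = Δ^k(λ)`, and expand `∏_{Δ⁺ ∖ Ψ} (1 - R_{ij})` on the subscript `λ`. Row `i` has at most
`k - λ_i` roots outside `Ψ`, so every subscript that occurs has all its entries `≤ k`
(`sum_roots_add_le`). A nonempty sum of positive roots, added to the antitone weight `λ`, strictly
increases the sum of the squares of the entries (`sum_sq_lt`), a quantity that does not depend on
the order of the entries. Hence `s^{(k)}_λ = h_λ + ∑ c_μ h_μ` over `μ ∈ Par^k` of the size of `λ`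
and with larger sum of squares (`kSchur_sub_hPartition_mem`).

For the Katalan functions let `k_γ = ∏_i k^{(i-1)}_{γ_i}`. The Vandermonde determinant gives
`g_γ = ∏_{Δ⁺} (1 - R_{ij}) k_γ` (`gWeight_eq`). The geometric series over `Ψ` cancel the factors of
this product in `Ψ`, so that `𝔤^{(k)}_λ = ∏_M (1 - L_j) ∏_{Δ⁺ ∖ Ψ} (1 - R_{ij}) k_λ` (`katalan_eq`).
Lowering operators keep entries `≤ k`, so again only entries `≤ k` occur; a lowering operator
reduces the degree, and `k_γ - h_γ` is a combination of `h_μ` with `μ ∈ Par^k` and `|μ| < |γ|`.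
Therefore `𝔤^{(k)}_λ - s^{(k)}_λ` is a combination of such `h_μ` with `|μ| < |λ|`
(`kSchurKatalan_sub_kSchur_mem`).
-/

noncomputable section

namespace Katalan

/-! ### Algebraic independence of the complete homogeneous symmetric functions -/

/-- The recursion `∑ (-1)^i a_i b_{m-i} = 0` expresses `b_n` through `a_1, …, a_k` by a polynomial
that does not depend on the sequences. -/
theorem exists_universal_polynomial {A : Type*} [CommRing A] [Algebra ℤ A] (k n : ℕ) (hn : n ≤ k) :
    ∃ q : MvPolynomial (Fin k) ℤ, ∀ a b : ℕ → A, a 0 = 1 → b 0 = 1 →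
      (∀ m, 1 ≤ m → m ≤ k → ∑ p ∈ Finset.HasAntidiagonal.antidiagonal m,
        (-1) ^ p.1 * a p.1 * b p.2 = 0) →
      MvPolynomial.aeval (fun i : Fin k => a (i + 1)) q = b n := by
  induction n using Nat.strong_induction_on with
  | _ n ih =>
    rcases Nat.eq_zero_or_pos n with rfl | hpos
    · exact ⟨1, fun a b _ hb _ => by simp [hb]⟩
    · choose q hq using ih
      refine ⟨-∑ i : Fin n, (-1) ^ ((i : ℕ) + 1) *
        MvPolynomial.X (⟨i, i.2.trans_le hn⟩ : Fin k) *
          q (n - (i + 1)) (by omega) (by omega), fun a b ha hb hab => ?_⟩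
      have hrel := hab n hpos hn
      rw [Finset.Nat.sum_antidiagonal_eq_sum_range_succ_mk, Finset.sum_range_succ'] at hrel
      simp only [ha, pow_zero, one_mul, Nat.sub_zero] at hrel
      rw [map_neg, map_sum, ← Fin.sum_univ_eq_sum_range
        (fun i => (-1 : A) ^ (i + 1) * a (i + 1) * b (n - (i + 1)))] at *
      rw [eq_neg_of_add_eq_zero_right hrel]
      refine congrArg _ (Finset.sum_congr rfl fun i _ => ?_)
      simp [hq _ _ _ a b ha hb hab]

/-- Since the recursion is symmetric in `a` and `b`, the substitution `θ` sending the variables to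
the universal polynomials exchanges the two evaluations, and is an involution if the `a_i` are
algebraically independent. -/
theorem algebraicIndependent_of_dual {A : Type*} [CommRing A] [Algebra ℤ A] {k : ℕ} {a b : ℕ → A}
    (ha : a 0 = 1) (hb : b 0 = 1)
    (hab : ∀ m, 1 ≤ m → m ≤ k →
      ∑ p ∈ Finset.HasAntidiagonal.antidiagonal m, (-1) ^ p.1 * a p.1 * b p.2 = 0)
    (hind : AlgebraicIndependent ℤ fun i : Fin k => a (i + 1)) :
    AlgebraicIndependent ℤ fun i : Fin k => b (i + 1) := by
  choose q hq using fun i : Fin k => exists_universal_polynomial (A := A) k (i + 1) i.2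
  have hba : ∀ m, 1 ≤ m → m ≤ k →
      ∑ p ∈ Finset.HasAntidiagonal.antidiagonal m, (-1) ^ p.1 * b p.1 * a p.2 = 0 := by
    intro m h1 h2
    rw [← Finset.Nat.sum_antidiagonal_swap]
    have := congrArg (fun x => (-1) ^ m * x) (hab m h1 h2)
    simp only [mul_zero, Finset.mul_sum] at this
    rw [← this]
    refine Finset.sum_congr rfl fun p hp => ?_
    rw [← Finset.HasAntidiagonal.mem_antidiagonal.1 hp, pow_add]
    have : ((-1 : A) ^ p.1) * (-1) ^ p.1 = 1 := by rw [← mul_pow]; simp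
    simp only [Prod.fst_swap, Prod.snd_swap]
    linear_combination (-((-1) ^ p.2 * a p.1 * b p.2)) * this
  have h1 : (MvPolynomial.aeval (R := ℤ) fun i : Fin k => a (i + 1)).comp (MvPolynomial.aeval q) =
      MvPolynomial.aeval fun i : Fin k => b (i + 1) := by
    ext i; simp [hq i a b ha hb hab]
  have h2 : (MvPolynomial.aeval (R := ℤ) fun i : Fin k => b (i + 1)).comp (MvPolynomial.aeval q) =
      MvPolynomial.aeval fun i : Fin k => a (i + 1) := by
    ext i; simp [hq i b a hb ha hba]
  have hinv : Function.LeftInverse (MvPolynomial.aeval (R := ℤ) q) (MvPolynomial.aeval q) := by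
    intro x
    apply hind
    change ((MvPolynomial.aeval (R := ℤ) fun i : Fin k => a (i + 1)).comp
      (MvPolynomial.aeval q)) _ = _
    rw [h1]
    exact DFunLike.congr_fun h2 x
  show Function.Injective _
  rw [← h1]
  rw [AlgHom.coe_comp]
  exact Function.Injective.comp hind hinv.injective

/-- The complete homogeneous symmetric polynomial `h_m` in `k` variables, as a power series; it is
the image of `h m` under `x_i ↦ 0` for `i ≥ k`. -/
def hFin (k : ℕ) (m : ℤ) : MvPowerSeries (Fin k) ℤ := fun d => if (d.degree : ℤ) = m then 1 else 0

theorem killCompl_h (k : ℕ) (m : ℤ) :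
    MvPowerSeries.killCompl Fin.valEmbedding (h m) = hFin k m := by
  ext d
  rw [MvPowerSeries.coeff_killCompl]
  show (if _ then _ else _) = (if _ then _ else _)
  have : (Finsupp.embDomain Fin.valEmbedding d).degree = d.degree := by
    rw [Finsupp.embDomain_eq_mapDomain, Finsupp.degree_mapDomain]
  rw [this]

theorem coeff_h (m : ℤ) (d : ℕ →₀ ℕ) :
    MvPowerSeries.coeff d (h m) = if (d.degree : ℤ) = m then 1 else 0 := rfl

theorem coeff_hFin (k : ℕ) (m : ℤ) (d : Fin k →₀ ℕ) :
    MvPowerSeries.coeff d (hFin k m) = if (d.degree : ℤ) = m then 1 else 0 := rfl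

theorem h_zero : h 0 = 1 := by
  ext d
  simp [coeff_h, MvPowerSeries.coeff_one, Finsupp.degree_eq_zero_iff]

theorem hFin_zero (k : ℕ) : hFin k 0 = 1 := by
  ext d
  simp [coeff_hFin, MvPowerSeries.coeff_one, Finsupp.degree_eq_zero_iff]

theorem h_of_neg {m : ℤ} (hm : m < 0) : h m = 0 := by
  ext d
  rw [coeff_h, if_neg (by omega), map_zero]

/-- The relation `∑ (-1)^i e_i h_{n-i} = 0` with each `e_i` written out as a sum over subsets `t`.
The coefficient at a monomial of degree `n` with support `D` is `∑_{t ⊆ D} (-1)^|t| = 0`. -/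
theorem sum_subsets_mul_hFin (k n : ℕ) (hn : 0 < n) :
    ∑ t : Finset (Fin k), (-1) ^ t.card *
      MvPowerSeries.monomial (∑ i ∈ t, Finsupp.single i 1) (1 : ℤ) * hFin k (n - t.card) = 0 := by
  ext d
  rw [map_sum, map_zero]
  have key : ∀ t : Finset (Fin k), MvPowerSeries.coeff d ((-1) ^ t.card *
      MvPowerSeries.monomial (∑ i ∈ t, Finsupp.single i 1) (1 : ℤ) * hFin k (n - t.card)) =
      if t ⊆ d.support then (if d.degree = n then (-1) ^ t.card else 0) else 0 := by
    intro t
    have hc : ((-1 : MvPowerSeries (Fin k) ℤ) ^ t.card) =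
      MvPowerSeries.C ((-1 : ℤ) ^ t.card) := by simp
    have hle : (∑ i ∈ t, Finsupp.single i 1) ≤ d ↔ t ⊆ d.support := by
      rw [Finsupp.le_def]
      simp only [Finsupp.finsetSum_apply, Finsupp.single_apply, Finset.sum_ite_eq']
      constructor
      · intro h i hi
        have := h i
        rw [if_pos hi] at this
        rw [Finsupp.mem_support_iff]; omega
      · intro h i
        split_ifs with hi
        · have := Finsupp.mem_support_iff.1 (h hi); omega
        · omega
    have hd : t ⊆ d.support →
        (d - ∑ i ∈ t, Finsupp.single i 1).degree + t.card = d.degree := by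
      intro ht
      conv_rhs => rw [← tsub_add_cancel_of_le (hle.2 ht)]
      simp [map_add, map_sum]
    rw [hc, mul_assoc, MvPowerSeries.coeff_C_mul, MvPowerSeries.coeff_monomial_mul]
    simp only [hle]
    split_ifs with h1 h2
    · rw [coeff_hFin, if_pos (by have := hd h1; omega)]; simp
    · rw [coeff_hFin, if_neg (by have := hd h1; omega)]; simp
    · simp
  simp_rw [key]
  rw [← Finset.sum_filter]
  have hf : (Finset.univ.filter fun t : Finset (Fin k) => t ⊆ d.support) = d.support.powerset := by
    ext; simp
  rw [hf]
  split_ifs with h1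
  · rw [Finset.sum_powerset_neg_one_pow_card, if_neg]
    intro h0
    rw [Finsupp.support_eq_empty.1 h0, map_zero] at h1
    omega
  · simp

theorem esymm_mul_hFin (k n : ℕ) (hn : 0 < n) :
    ∑ p ∈ Finset.HasAntidiagonal.antidiagonal n, (-1) ^ p.1 *
      ((MvPolynomial.esymm (Fin k) ℤ p.1 : MvPolynomial (Fin k) ℤ) : MvPowerSeries (Fin k) ℤ) *
        hFin k p.2 = 0 := by
  have hneg : ∀ m : ℤ, m < 0 → hFin k m = 0 := fun m hm => by
    ext d
    rw [coeff_hFin, if_neg (by omega), map_zero]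
  rw [← sum_subsets_mul_hFin k n hn, Finset.Nat.sum_antidiagonal_eq_sum_range_succ_mk]
  have hfil : ∀ t : Finset (Fin k), t ∈ Finset.univ → (-1) ^ t.card *
      MvPowerSeries.monomial (∑ i ∈ t, Finsupp.single i 1) (1 : ℤ) * hFin k (n - t.card) ≠ 0 →
      t.card ∈ Finset.range (n + 1) := by
    intro t _ ht
    by_contra hc
    rw [Finset.mem_range] at hc
    exact ht (by rw [hneg _ (by omega), mul_zero])
  rw [← Finset.sum_filter_of_ne hfil, ← Finset.sum_fiberwise_eq_sum_filter]
  refine Finset.sum_congr rfl fun i hi => ?_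
  have hset : (Finset.univ.filter fun t : Finset (Fin k) => t.card = i) =
      Finset.powersetCard i Finset.univ := by ext; simp [Finset.mem_powersetCard]
  rw [hset, MvPolynomial.esymm_eq_sum_monomial, ← MvPolynomial.coeToMvPowerSeries.ringHom_apply,
    map_sum, Finset.mul_sum, Finset.sum_mul]
  refine Finset.sum_congr rfl fun t ht => ?_
  have hcard := (Finset.mem_powersetCard.1 ht).2
  have hi' := Finset.mem_range.1 hi
  rw [hcard, MvPolynomial.coeToMvPowerSeries.ringHom_apply, MvPolynomial.coe_monomial,
    Nat.cast_sub (by omega)]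

theorem algebraicIndependent_hFin (k : ℕ) :
    AlgebraicIndependent ℤ fun i : Fin k => hFin k ((i + 1 : ℕ) : ℤ) := by
  refine algebraicIndependent_of_dual (k := k)
    (a := fun n => ((MvPolynomial.esymm (Fin k) ℤ n : MvPolynomial (Fin k) ℤ) :
      MvPowerSeries (Fin k) ℤ)) (b := fun n => hFin k n) (by simp) (by simpa using hFin_zero k)
    (fun m hm _ => esymm_mul_hFin k m hm) ?_
  have h1 : AlgebraicIndependent ℤ fun i : Fin k => MvPolynomial.esymm (Fin k) ℤ (i + 1) := by
    have h2 := (MvPolynomial.esymmAlgHom_injective (σ := Fin k) (n := k) ℤ (by simp))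
    have h3 : MvPolynomial.aeval (fun i : Fin k => MvPolynomial.esymm (Fin k) ℤ (i + 1)) =
      (Subalgebra.val _).comp (MvPolynomial.esymmAlgHom (Fin k) ℤ k) := by
      ext i : 1
      simp [MvPolynomial.esymmAlgHom]
    show Function.Injective _
    rw [h3]
    exact Subtype.val_injective.comp h2
  have h2 := h1.map' (f := MvPolynomial.coeToMvPowerSeries.algHom (σ := Fin k) (R := ℤ) ℤ)
    (fun x y hxy => MvPolynomial.coe_injective (Fin k) ℤ (by simpa using hxy))
  convert h2 using 2
  simp

theorem algebraicIndependent_h (k : ℕ) :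
    AlgebraicIndependent ℤ fun i : Fin k => h ((i + 1 : ℕ) : ℤ) := by
  refine AlgebraicIndependent.of_comp
    (MvPowerSeries.killCompl (R := ℤ) (Fin.valEmbedding (n := k))) ?_
  convert algebraicIndependent_hFin k using 2
  exact killCompl_h k _

/-! ### Unitriangular families -/

section Triangular

variable {R ι E : Type*} [CommRing R] [AddCommGroup E] [Module R E] {b v : ι → E}
  {rel : ι → ι → Prop}

/-- A family that differs from a linearly independent one by terms of smaller rank is linearly
independent: a dependency has a nonzero coefficient at any index of maximal rank in its support. -/
theorem linearIndependent_of_unitriangular (hb : LinearIndependent R b) (r : ι → ℕ)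
    (hv : ∀ i, v i - b i ∈ Submodule.span R (b '' {j | r j < r i})) : LinearIndependent R v := by
  choose N hN hNv using fun i => (Finsupp.mem_span_image_iff_linearCombination R).1 (hv i)
  have hcomb : ∀ c : ι →₀ R, Finsupp.linearCombination R v c = Finsupp.linearCombination R b
      (c + Finsupp.linearCombination R N c) := by
    intro c
    induction c using Finsupp.induction_linear with
    | zero => simp
    | add c d hc hd => simp only [map_add, hc, hd]; abel
    | single i n =>
      rw [map_add, Finsupp.linearCombination_single, Finsupp.linearCombination_single,
        Finsupp.linearCombination_single, map_smul, hNv, smul_sub]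
      abel
  rw [linearIndependent_iff]
  intro c hc
  rw [hcomb] at hc
  have h0 := linearIndependent_iff.1 hb _ hc
  by_contra hne
  obtain ⟨i, hi, hmax⟩ := c.support.exists_max_image r (Finsupp.support_nonempty_iff.2 hne)
  have hNi : Finsupp.linearCombination R N c i = 0 := by
    rw [Finsupp.linearCombination_apply, Finsupp.sum, Finsupp.finsetSum_apply]
    refine Finset.sum_eq_zero fun j hj => ?_
    have : N j i = 0 := by
      by_contra h1
      have h2 := (Finsupp.mem_supported _ _).1 (hN j) (Finsupp.mem_support_iff.2 h1)
      exact absurd (hmax j hj) (not_le.2 h2)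
    simp [this]
  have := DFunLike.congr_fun h0 i
  rw [Finsupp.add_apply, hNi, add_zero] at this
  exact Finsupp.mem_support_iff.1 hi this

/-- A unitriangular change of family preserves the spans of all index sets closed under the
triangularity relation. -/
theorem span_image_eq_of_unitriangular (r : ι → ℕ)
    (hr : ∀ i j, rel j i → r j < r i)
    (hv : ∀ i, v i - b i ∈ Submodule.span R (b '' {j | rel j i}))
    {T : Set ι} (hT : ∀ i ∈ T, ∀ j, rel j i → j ∈ T) :
    Submodule.span R (v '' T) = Submodule.span R (b '' T) := by
  refine le_antisymm (Submodule.span_le.2 ?_) (Submodule.span_le.2 ?_)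
  · rintro _ ⟨i, hi, rfl⟩
    have h1 := Submodule.span_mono (Set.image_mono (f := b) (hT i hi)) (hv i)
    have h2 := Submodule.subset_span (R := R) (Set.mem_image_of_mem b hi)
    simpa using add_mem h1 h2
  · suffices ∀ n i, r i = n → i ∈ T → b i ∈ Submodule.span R (v '' T) by
      rintro _ ⟨i, hi, rfl⟩
      exact this _ i rfl hi
    intro n
    induction n using Nat.strong_induction_on with
    | _ n ih =>
      rintro i rfl hi
      have h1 : Submodule.span R (b '' {j | rel j i}) ≤ Submodule.span R (v '' T) := by
        refine Submodule.span_le.2 ?_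
        rintro _ ⟨j, hj, rfl⟩
        exact ih _ (hr i j hj) j rfl (hT i hi j hj)
      have h2 := Submodule.subset_span (R := R) (Set.mem_image_of_mem v hi)
      simpa using sub_mem h2 (h1 (hv i))

end Triangular

theorem exists_basis_of_mem_span_iff {ι A : Type*} [CommRing A] [Algebra ℤ A] {S : Subalgebra ℤ A}
    {v : ι → A} (hv : LinearIndependent ℤ v)
    (hs : ∀ x, x ∈ Submodule.span ℤ (Set.range v) ↔ x ∈ S) :
    ∃ B : Module.Basis ι ℤ S, ∀ i, (B i : A) = v i := by
  let f : S →ₗ[ℤ] A := (S.subtype : S →+ A).toIntLinearMap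
  have hf : Function.Injective f := Subtype.val_injective
  let v' : ι → S := fun i => ⟨v i, (hs _).1 (Submodule.subset_span ⟨i, rfl⟩)⟩
  have hli : LinearIndependent ℤ v' := LinearIndependent.of_comp f hv
  refine ⟨Module.Basis.mk hli fun x _ => ?_, fun i => by rw [Module.Basis.mk_apply]⟩
  have hx : f x ∈ Submodule.span ℤ (f '' Set.range v') := by
    rw [← Set.range_comp]
    exact (hs _).2 x.2
  rw [← Submodule.map_span] at hx
  obtain ⟨y, hy, hyx⟩ := hx
  exact hf hyx ▸ hy

/-- Two-step triangularity: `s` is obtained from the basis `b` of `S` inside each degree, and `g`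
from `s` by adding terms of lower degree. -/
theorem exists_bases_of_unitriangular {ι A : Type*} [CommRing A] [Algebra ℤ A] {S : Subalgebra ℤ A}
    {b s g : ι → A} (hb : LinearIndependent ℤ b)
    (hS : ∀ x, x ∈ Submodule.span ℤ (Set.range b) ↔ x ∈ S) (deg rank : ι → ℕ)
    (hs : ∀ i, s i - b i ∈ Submodule.span ℤ (b '' {j | deg j = deg i ∧ rank j < rank i}))
    (hg : ∀ i, g i - s i ∈ Submodule.span ℤ (b '' {j | deg j < deg i})) :
    (∃ B : Module.Basis ι ℤ S, ∀ i, (B i : A) = g i) ∧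
    (∃ B : Module.Basis ι ℤ S, ∀ i, (B i : A) = s i) ∧
    ∀ i, ∃ a : ι →₀ ℤ, (∀ j, a j ≠ 0 → deg j < deg i) ∧ g i = s i + a.sum fun j c => c • s j := by
  have hs_span : ∀ T : Set ι, (∀ i ∈ T, ∀ j, deg j = deg i ∧ rank j < rank i → j ∈ T) →
      Submodule.span ℤ (s '' T) = Submodule.span ℤ (b '' T) := fun T hT =>
    span_image_eq_of_unitriangular rank (fun i j hij => hij.2) hs hT
  have hgs : ∀ i, g i - s i ∈ Submodule.span ℤ (s '' {j | deg j < deg i}) := fun i => by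
    rw [hs_span {j | deg j < deg i} fun j hj m hm => hm.1.trans_lt hj]
    exact hg i
  have hs_li : LinearIndependent ℤ s := linearIndependent_of_unitriangular hb rank fun i =>
    Submodule.span_mono (Set.image_mono fun j hj => hj.2) (hs i)
  have hg_li : LinearIndependent ℤ g := linearIndependent_of_unitriangular hs_li deg hgs
  have hs_mem : ∀ x, x ∈ Submodule.span ℤ (Set.range s) ↔ x ∈ S := fun x => by
    have := hs_span Set.univ fun _ _ j _ => Set.mem_univ j
    rw [Set.image_univ, Set.image_univ] at this
    rw [this, hS]
  have hg_mem : ∀ x, x ∈ Submodule.span ℤ (Set.range g) ↔ x ∈ S := fun x => by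
    have := span_image_eq_of_unitriangular (rel := fun j i => deg j < deg i) deg
      (fun i j hij => hij) hgs (T := Set.univ) fun _ _ j _ => Set.mem_univ j
    rw [Set.image_univ, Set.image_univ] at this
    rw [this, hs_mem]
  refine ⟨exists_basis_of_mem_span_iff hg_li hg_mem, exists_basis_of_mem_span_iff hs_li hs_mem,
    fun i => ?_⟩
  obtain ⟨a, ha, hsum⟩ := (Finsupp.mem_span_image_iff_linearCombination ℤ).1 (hgs i)
  exact ⟨a, fun j hj => (Finsupp.mem_supported _ _).1 ha (Finsupp.mem_support_iff.2 hj),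
    sub_eq_iff_eq_add'.1 hsum.symm⟩

/-- The multiset of the (positive) row lengths of a Young diagram. -/
def parts (μ : YoungDiagram) : Multiset ℕ := (μ.rowLens : Multiset ℕ)

theorem parts_injective : Function.Injective parts := by
  intro μ ν h
  have hp : List.Perm μ.rowLens ν.rowLens := Multiset.coe_eq_coe.1 h
  have := hp.eq_of_pairwise' μ.rowLens_sorted.pairwise ν.rowLens_sorted.pairwise
  exact YoungDiagram.equivListRowLens.injective (Subtype.ext this)

theorem pos_of_mem_parts {μ : YoungDiagram} {x : ℕ} (hx : x ∈ parts μ) : 0 < x :=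
  μ.pos_of_mem_rowLens x hx

theorem rowLen_eq_zero {μ : YoungDiagram} {i : ℕ} (hi : μ.colLen 0 ≤ i) : μ.rowLen i = 0 := by
  by_contra h
  have h1 : (i, 0) ∈ μ := YoungDiagram.mem_iff_lt_rowLen.2 (Nat.pos_of_ne_zero h)
  have := YoungDiagram.mem_iff_lt_colLen.1 h1
  omega

theorem parts_eq (μ : YoungDiagram) : parts μ = (Multiset.range (μ.colLen 0)).map μ.rowLen := rfl

theorem le_of_mem_parts {k : ℕ} (μ : BoundedPartition k) {x : ℕ} (hx : x ∈ parts μ.1) : x ≤ k := by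
  rw [parts_eq] at hx
  obtain ⟨i, _, rfl⟩ := Multiset.mem_map.1 hx
  exact (μ.1.rowLen_anti 0 i (Nat.zero_le i)).trans μ.2

theorem exists_parts_eq {k : ℕ} {w : Multiset ℕ} (hw : ∀ x ∈ w, 1 ≤ x ∧ x ≤ k) :
    ∃ μ : BoundedPartition k, parts μ.1 = w := by
  have hs : (w.sort (· ≥ ·)).SortedGE := (w.pairwise_sort (· ≥ ·)).sortedGE
  have hpos : ∀ x ∈ w.sort (· ≥ ·), 0 < x := fun x hx => (hw x ((Multiset.mem_sort _).1 hx)).1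
  have h := YoungDiagram.rowLens_ofRowLens_eq_self (hw := hs) hpos
  have hp : parts (YoungDiagram.ofRowLens _ hs) = w := by
    rw [parts, h]; exact Multiset.sort_eq _ _
  refine ⟨⟨YoungDiagram.ofRowLens _ hs, ?_⟩, hp⟩
  by_contra hlt
  have h0 : 0 < (YoungDiagram.ofRowLens _ hs).colLen 0 := by
    by_contra h0
    rw [rowLen_eq_zero (by omega)] at hlt
    omega
  refine hlt (hw _ ?_).2
  have : (YoungDiagram.ofRowLens _ hs).rowLen 0 ∈ parts (YoungDiagram.ofRowLens _ hs) := by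
    rw [parts_eq]
    exact Multiset.mem_map_of_mem _ (Multiset.mem_range.2 h0)
  rwa [hp] at this

theorem card_eq_sum_parts (μ : YoungDiagram) : μ.card = (parts μ).sum := by
  have h1 : ∀ c ∈ μ.cells, c.1 ∈ Finset.range (μ.colLen 0) := by
    rintro ⟨i, j⟩ hc
    have : (i, 0) ∈ μ := μ.up_left_mem le_rfl (Nat.zero_le j) hc
    exact Finset.mem_range.2 (YoungDiagram.mem_iff_lt_colLen.1 this)
  rw [YoungDiagram.card, Finset.card_eq_sum_card_fiberwise h1, parts_eq]
  exact Finset.sum_congr rfl fun i _ => (μ.rowLen_eq_card).symm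

theorem prod_weight {M : Type*} [CommMonoid M] (F : ℤ → M) (hF : F 0 = 1) {μ : YoungDiagram}
    {l : ℕ} (hl : μ.colLen 0 ≤ l) :
    ∏ i, F (weight μ l i) = ((parts μ).map fun x : ℕ => F x).prod := by
  rw [parts_eq, Multiset.map_map]
  change _ = ∏ i ∈ Finset.range (μ.colLen 0), F (μ.rowLen i)
  rw [Finset.prod_subset (Finset.range_mono hl)]
  · exact Fin.prod_univ_eq_prod_range (fun i => F (μ.rowLen i)) l
  · intro i _ hi
    rw [rowLen_eq_zero (by simpa using hi), Nat.cast_zero, hF]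

theorem sum_weight {M : Type*} [AddCommMonoid M] (F : ℤ → M) (hF : F 0 = 0) {μ : YoungDiagram}
    {l : ℕ} (hl : μ.colLen 0 ≤ l) :
    ∑ i, F (weight μ l i) = ((parts μ).map fun x : ℕ => F x).sum :=
  prod_weight (M := Multiplicative M) (fun x => Multiplicative.ofAdd (F x)) hF hl

/-- The product `h_μ = h_{μ_1} h_{μ_2} ⋯`. -/
def hPartition {k : ℕ} (μ : BoundedPartition k) : Series :=
  ((parts μ.1).map fun x : ℕ => h x).prod

theorem hWeight_weight {k : ℕ} (μ : BoundedPartition k) {l : ℕ} (hl : μ.1.colLen 0 ≤ l) :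
    hWeight (weight μ.1 l) = hPartition μ := prod_weight h h_zero hl

/-- Sorting the entries of `β` and removing zeros gives a partition `μ` with `h_μ = h_β`, the same
sum and the same sum of squares. -/
theorem exists_hPartition_eq {k l : ℕ} {β : Fin l → ℤ} (h0 : ∀ i, 0 ≤ β i) (hk : ∀ i, β i ≤ k) :
    ∃ μ : BoundedPartition k, hPartition μ = hWeight β ∧ (μ.1.card : ℤ) = ∑ i, β i ∧
      ((parts μ.1).map fun x : ℕ => (x : ℤ) ^ 2).sum = ∑ i, β i ^ 2 := by
  obtain ⟨μ, hμ⟩ := exists_parts_eq (k := k)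
    (w := (Finset.univ.val.map fun i => (β i).toNat).filter (0 < ·)) (by
      intro x hx
      obtain ⟨hx1, hx2⟩ := Multiset.mem_filter.1 hx
      obtain ⟨i, _, rfl⟩ := Multiset.mem_map.1 hx1
      have := hk i
      omega)
  have key : ∀ {M : Type} [CommMonoid M] (F : ℤ → M), F 0 = 1 →
      ((parts μ.1).map fun x : ℕ => F x).prod = ∏ i, F (β i) := by
    intro M _ F hF
    rw [hμ]
    have : ∀ w : Multiset ℕ, ((w.filter (0 < ·)).map fun x : ℕ => F x).prod =
        (w.map fun x : ℕ => F x).prod := by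
      intro w
      induction w using Multiset.induction_on with
      | empty => simp
      | cons a w ih =>
        rcases Nat.eq_zero_or_pos a with rfl | ha
        · simp [ih, hF]
        · simp [ha, ih]
    rw [this, Multiset.map_map]
    refine Finset.prod_congr rfl fun i _ => ?_
    simp [h0 i]
  have key' : ∀ (F : ℤ → ℤ), F 0 = 0 →
      ((parts μ.1).map fun x : ℕ => F x).sum = ∑ i, F (β i) := fun F hF =>
    key (M := Multiplicative ℤ) (fun x => Multiplicative.ofAdd (F x)) hF
  refine ⟨μ, key h h_zero, ?_, key' (· ^ 2) (by simp)⟩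
  rw [card_eq_sum_parts]
  have := key' id rfl
  simp only [id] at this
  rw [← this]
  exact map_multiset_sum (Nat.castAddMonoidHom ℤ) _

theorem linearIndependent_hPartition (k : ℕ) :
    LinearIndependent ℤ (hPartition : BoundedPartition k → Series) := by
  have h1 := (MvPolynomial.basisMonomials (Fin k) ℤ).linearIndependent.map'
    (MvPolynomial.aeval (R := ℤ) fun i : Fin k => h ((i + 1 : ℕ) : ℤ)).toLinearMap
    (LinearMap.ker_eq_bot.2 (algebraicIndependent_h k))
  -- `h_μ` is the image of the monomial whose exponents are the multiplicities of the parts of `μ`.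
  let m : BoundedPartition k → (Fin k →₀ ℕ) := fun μ =>
    Finsupp.equivFunOnFinite.symm fun i => (parts μ.1).count ((i : ℕ) + 1)
  have hm : Function.Injective m := by
    intro μ ν hμν
    refine Subtype.ext (parts_injective (Multiset.ext.2 fun x => ?_))
    by_cases hx : 1 ≤ x ∧ x ≤ k
    · have := DFunLike.congr_fun hμν ⟨x - 1, by omega⟩
      simpa [m, Nat.sub_add_cancel hx.1] using this
    · rw [Multiset.count_eq_zero_of_notMem, Multiset.count_eq_zero_of_notMem]
      · exact fun h => hx ⟨pos_of_mem_parts h, le_of_mem_parts ν h⟩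
      · exact fun h => hx ⟨pos_of_mem_parts h, le_of_mem_parts μ h⟩
  suffices heq : (hPartition : BoundedPartition k → Series) =
      ((MvPolynomial.aeval (R := ℤ) fun i : Fin k => h ((i + 1 : ℕ) : ℤ)).toLinearMap ∘
        MvPolynomial.basisMonomials (Fin k) ℤ) ∘ m by
    rw [heq]
    convert h1.comp m hm
    -- The two `ℤ`-module structures on power series agree.
    exacts [rfl, rfl, (AddCommGroup.uniqueIntModule.uniq _).symm]
  funext μ
  simp only [Function.comp, MvPolynomial.coe_basisMonomials, AlgHom.toLinearMap_apply,
    MvPolynomial.aeval_monomial, map_one, one_mul]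
  rw [Finsupp.prod_fintype _ _ (fun i => pow_zero _), hPartition,
    Finset.prod_multiset_map_count, Finset.prod_subset
      (s₂ := Finset.univ.image fun i : Fin k => (i : ℕ) + 1)]
  · rw [Finset.prod_image fun i _ j _ hij => Fin.ext (by simpa using hij)]
    rfl
  · intro x hx
    have h2 := Multiset.mem_toFinset.1 hx
    have h3 := pos_of_mem_parts h2
    have h4 := le_of_mem_parts μ h2
    exact Finset.mem_image.2 ⟨⟨x - 1, by omega⟩, Finset.mem_univ _, by simp; omega⟩
  · intro x _ hx
    rw [Multiset.count_eq_zero_of_notMem (by simpa using hx), pow_zero]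

theorem mem_span_hPartition (k : ℕ) (f : Series) :
    f ∈ Submodule.span ℤ (Set.range (hPartition : BoundedPartition k → Series)) ↔
      f ∈ lambdaSub k := by
  rw [lambdaSub, ← Subalgebra.mem_toSubmodule, Algebra.adjoin_eq_span]
  suffices Set.range (hPartition : BoundedPartition k → Series) =
      Submonoid.closure {f | ∃ m : ℕ, 1 ≤ m ∧ m ≤ k ∧ f = h m} by
    rw [this]
    congr!
  ext f
  constructor
  · rintro ⟨μ, rfl⟩
    refine Submonoid.multiset_prod_mem _ _ fun x hx => ?_
    obtain ⟨m, hm, rfl⟩ := Multiset.mem_map.1 hx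
    exact Submonoid.subset_closure ⟨m, pos_of_mem_parts hm, le_of_mem_parts μ hm, rfl⟩
  · intro hf
    suffices ∃ w : Multiset ℕ, (∀ x ∈ w, 1 ≤ x ∧ x ≤ k) ∧ (w.map fun x : ℕ => h x).prod = f by
      obtain ⟨w, hw, rfl⟩ := this
      obtain ⟨μ, hμ⟩ := exists_parts_eq hw
      exact ⟨μ, by rw [hPartition, hμ]⟩
    induction hf using Submonoid.closure_induction with
    | mem x hx =>
      obtain ⟨m, h1, h2, rfl⟩ := hx
      exact ⟨{m}, by simp [h1, h2], by simp⟩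
    | one => exact ⟨0, by simp, by simp⟩
    | mul x y _ _ hx hy =>
      obtain ⟨w, hw, rfl⟩ := hx
      obtain ⟨w', hw', rfl⟩ := hy
      refine ⟨w + w', fun x hx => ?_, by simp⟩
      rcases Multiset.mem_add.1 hx with hx | hx
      exacts [hw x hx, hw' x hx]

/-! ### Raising and lowering operators as Laurent polynomials -/

variable {l : ℕ}

theorem mono_add (β γ : Fin l → ℤ) : mono (β + γ) = mono β * mono γ := by
  simp [mono, AddMonoidAlgebra.single_mul_single]

theorem mono_zero : mono (0 : Fin l → ℤ) = 1 := rfl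

theorem mono_nsmul (n : ℕ) (β : Fin l → ℤ) : mono (n • β) = mono β ^ n := by
  induction n with
  | zero => simp [mono_zero]
  | succ n ih => rw [succ_nsmul, mono_add, ih, pow_succ]

theorem mono_sum {ι : Type*} (s : Finset ι) (β : ι → Fin l → ℤ) :
    mono (∑ i ∈ s, β i) = ∏ i ∈ s, mono (β i) := by
  induction s using Finset.cons_induction with
  | empty => simp [mono_zero]
  | cons a s ha ih => rw [Finset.sum_cons, Finset.prod_cons, mono_add, ih]

theorem span_mono : Submodule.span ℤ (Set.range (mono (l := l))) = ⊤ := by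
  refine eq_top_iff.2 fun f _ => ?_
  induction f using AddMonoidAlgebra.induction_linear with
  | zero => exact zero_mem _
  | add f g hf hg => exact add_mem (hf trivial) (hg trivial)
  | single γ n =>
    have : (AddMonoidAlgebra.single γ n : Laurent l) = n • mono γ := by
      simp [mono, AddMonoidAlgebra.smul_single]
    rw [this]
    exact Submodule.smul_mem _ _ (Submodule.subset_span ⟨γ, rfl⟩)

/-- The linear map `f ↦ ∑_γ f_γ F_γ`, that is, `evalWeights F`. -/
def evalHom (F : (Fin l → ℤ) → Series) : Laurent l →ₗ[ℤ] Series :=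
  AddMonoidHom.toIntLinearMap
    { toFun := evalWeights F
      map_zero' := by simp [evalWeights]
      map_add' := fun f g => by
        unfold evalWeights
        rw [AddMonoidAlgebra.coeff_add]
        exact Finsupp.sum_add_index' (fun _ => zero_smul _ _) fun _ _ _ => add_smul _ _ _ }

theorem evalHom_apply (F : (Fin l → ℤ) → Series) (f : Laurent l) :
    evalHom F f = evalWeights F f := rfl

theorem evalHom_mono (F : (Fin l → ℤ) → Series) (γ : Fin l → ℤ) : evalHom F (mono γ) = F γ := by
  rw [evalHom_apply, evalWeights, mono, AddMonoidAlgebra.coeff_single, Finsupp.sum_single_index]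
  · exact one_smul _ _
  · exact zero_smul _ _

/-- `k_γ = k^{(0)}_{γ_1} k^{(1)}_{γ_2} ⋯ k^{(ℓ-1)}_{γ_ℓ}`. -/
def kWeight (γ : Fin l → ℤ) : Series := ∏ i : Fin l, kInhom ((i : ℕ) : ℤ) (γ i)

theorem kWeight_of_neg {γ : Fin l → ℤ} {i : Fin l} (hi : γ i < 0) : kWeight γ = 0 :=
  Finset.prod_eq_zero (Finset.mem_univ i) (kInhom_of_neg _ hi)

/-- The Vandermonde determinant `det (z_i^j)` divided by `∏_j z_j^j`, with indices from `0`. -/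
theorem prod_positiveRoots (l : ℕ) :
    ∏ p ∈ positiveRoots l, (1 - mono (root p)) =
      ∑ σ : Equiv.Perm (Fin l), Equiv.Perm.sign σ •
        mono (fun i => ((σ i : ℕ) : ℤ) - ((i : ℕ) : ℤ)) := by
  have h1 := Matrix.det_vandermonde fun i : Fin l => mono (Pi.single i (1 : ℤ))
  have h2 : ∏ p ∈ positiveRoots l, (1 - mono (root p)) =
      (∏ i : Fin l, ∏ j ∈ Finset.Ioi i, (mono (Pi.single j 1) - mono (Pi.single i 1))) *
        mono (-fun i : Fin l => ((i : ℕ) : ℤ)) := by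
    have h3 : ∏ p ∈ positiveRoots l, (1 - mono (root p)) =
        ∏ i : Fin l, ∏ j ∈ Finset.Ioi i, (1 - mono (root (i, j))) := by
      rw [Finset.prod_sigma']
      refine Finset.prod_bij' (fun p _ => ⟨p.1, p.2⟩) (fun p _ => (p.1, p.2)) ?_ ?_ ?_ ?_ ?_ <;>
        simp [positiveRoots]
    have h4 : (-fun i : Fin l => ((i : ℕ) : ℤ)) =
        ∑ i : Fin l, ∑ j ∈ Finset.Ioi i, -Pi.single j (1 : ℤ) := by
      rw [Finset.sum_comm' (t' := Finset.univ) (s' := fun j => Finset.Iio j) (by simp)]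
      funext x
      simp [Finset.sum_apply, Pi.single_apply]
    rw [h3, h4, mono_sum, ← Finset.prod_mul_distrib]
    refine Finset.prod_congr rfl fun i _ => ?_
    rw [mono_sum, ← Finset.prod_mul_distrib]
    refine Finset.prod_congr rfl fun j _ => ?_
    rw [sub_mul, ← mono_add, ← mono_add, add_neg_cancel, mono_zero, root, ← sub_eq_add_neg]
  rw [h2, ← h1, ← Matrix.det_transpose, Matrix.det_apply, Finset.sum_mul]
  refine Finset.sum_congr rfl fun σ _ => ?_
  have h3 : (fun i => ((σ i : ℕ) : ℤ) - ((i : ℕ) : ℤ)) =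
      ∑ i : Fin l, (σ i : ℕ) • Pi.single i (1 : ℤ) + -fun i : Fin l => ((i : ℕ) : ℤ) := by
    funext x
    simp [Finset.sum_apply, Pi.single_apply, sub_eq_add_neg]
  rw [h3, mono_add, mono_sum, smul_mul_assoc]
  simp only [mono_nsmul, Matrix.transpose_apply, Matrix.vandermonde_apply]

/-- `g_γ = ∏_{Δ⁺} (1 - R_{ij}) k_γ`. -/
theorem gWeight_eq (γ : Fin l → ℤ) :
    gWeight γ = evalHom kWeight ((∏ p ∈ positiveRoots l, (1 - mono (root p))) * mono γ) := by
  rw [prod_positiveRoots, Finset.sum_mul, map_sum, gWeight, ← Matrix.det_transpose,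
    Matrix.det_apply]
  refine Finset.sum_congr rfl fun σ _ => ?_
  have h1 : (Equiv.Perm.sign σ • mono (fun i => ((σ i : ℕ) : ℤ) - ((i : ℕ) : ℤ))) * mono γ =
      Equiv.Perm.sign σ • mono ((fun i => ((σ i : ℕ) : ℤ) - ((i : ℕ) : ℤ)) + γ) := by
    rw [mono_add, smul_mul_assoc]
  rw [h1, Units.smul_def, Units.smul_def, map_zsmul, evalHom_mono, kWeight]
  congr 1
  refine Finset.prod_congr rfl fun i _ => ?_
  simp only [Matrix.transpose_apply, Matrix.of_apply, Pi.add_apply]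
  congr 1
  ring

theorem evalHom_gWeight (f : Laurent l) :
    evalHom gWeight f = evalHom kWeight ((∏ p ∈ positiveRoots l, (1 - mono (root p))) * f) := by
  have : evalHom gWeight = (evalHom kWeight).comp
      ((AddMonoidHom.mulLeft (∏ p ∈ positiveRoots l, (1 - mono (root p)))).toIntLinearMap) := by
    refine LinearMap.ext_on_range span_mono fun γ => ?_
    rw [evalHom_mono, gWeight_eq]
    rfl
  rw [this]
  rfl

/-- The functional `∑ i · β_i`, with indices from `0`. It is negative on positive roots, and
`k_β = 0` if it is negative on `β`. -/
def height (β : Fin l → ℤ) : ℤ := ∑ i : Fin l, ((i : ℕ) : ℤ) * β i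

theorem height_add (β γ : Fin l → ℤ) : height (β + γ) = height β + height γ := by
  simp [height, mul_add, Finset.sum_add_distrib]

theorem height_root_neg {p : Fin l × Fin l} (hp : p ∈ positiveRoots l) : height (root p) ≤ -1 := by
  have : (p.1 : ℕ) < p.2 := by simpa [positiveRoots] using hp
  have h : height (root p) = ((p.1 : ℕ) : ℤ) - ((p.2 : ℕ) : ℤ) := by
    simp [height, root, mul_sub, Finset.sum_sub_distrib, Pi.single_apply]
  omega

/-- A subscript of negative height has a negative entry. -/
theorem kWeight_of_height_neg {γ : Fin l → ℤ} (h : height γ < 0) : kWeight γ = 0 := by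
  by_contra h0
  refine absurd h (not_lt.2 (Finset.sum_nonneg fun i _ => mul_nonneg (by positivity) ?_))
  by_contra hi
  exact h0 (kWeight_of_neg (not_le.1 hi))

/-- The span of the monomials `z^β` whose exponent satisfies `P`. -/
def monoSpan (P : (Fin l → ℤ) → Prop) : Submodule ℤ (Laurent l) :=
  Submodule.span ℤ (mono '' {β | P β})

theorem mono_mem {P : (Fin l → ℤ) → Prop} {β : Fin l → ℤ} (h : P β) : mono β ∈ monoSpan P :=
  Submodule.subset_span ⟨β, h, rfl⟩

theorem mono_mul_mem {P Q : (Fin l → ℤ) → Prop} {β : Fin l → ℤ} (h : ∀ γ, P γ → Q (β + γ))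
    {f : Laurent l} (hf : f ∈ monoSpan P) : mono β * f ∈ monoSpan Q := by
  induction hf using Submodule.span_induction with
  | mem x hx =>
    obtain ⟨γ, hγ, rfl⟩ := hx
    rw [← mono_add]
    exact mono_mem (h γ hγ)
  | zero => rw [mul_zero]; exact zero_mem _
  | add x y _ _ hx hy => rw [mul_add]; exact add_mem hx hy
  | smul n x _ hx => rw [mul_smul_comm]; exact Submodule.smul_mem _ _ hx

theorem monoSpan_mono {P Q : (Fin l → ℤ) → Prop} (h : ∀ γ, P γ → Q γ) :
    monoSpan P ≤ monoSpan Q := Submodule.span_mono (Set.image_mono h)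

theorem evalHom_mem {P : (Fin l → ℤ) → Prop} {F : (Fin l → ℤ) → Series} {W : Submodule ℤ Series}
    (h : ∀ γ, P γ → F γ ∈ W) {f : Laurent l} (hf : f ∈ monoSpan P) : evalHom F f ∈ W := by
  have : monoSpan P ≤ W.comap (evalHom F) := by
    refine Submodule.span_le.2 ?_
    rintro _ ⟨γ, hγ, rfl⟩
    show evalHom F (mono γ) ∈ W
    rw [evalHom_mono]
    exact h γ hγ
  exact this hf

theorem exists_height_le (f : Laurent l) : ∃ c : ℕ, f ∈ monoSpan fun β => height β ≤ c := by
  have hf : f ∈ Submodule.span ℤ (Set.range (mono (l := l))) := by rw [span_mono]; trivial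
  induction hf using Submodule.span_induction with
  | mem x hx =>
    obtain ⟨γ, rfl⟩ := hx
    exact ⟨(height γ).toNat, mono_mem (Int.self_le_toNat _)⟩
  | zero => exact ⟨0, zero_mem _⟩
  | add x y _ _ hx hy =>
    obtain ⟨c, hc⟩ := hx
    obtain ⟨d, hd⟩ := hy
    exact ⟨c + d, add_mem (monoSpan_mono (fun γ h => by push_cast; omega) hc)
      (monoSpan_mono (fun γ h => by push_cast; omega) hd)⟩
  | smul n x _ hx =>
    obtain ⟨c, hc⟩ := hx
    exact ⟨c, Submodule.smul_mem _ _ hc⟩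

/-- Large powers of the raising operators contribute nothing, since they make the height of every
exponent of `f` negative. -/
theorem evalHom_prod_one_sub_pow {S : Finset (Fin l × Fin l)} (hS : S ⊆ positiveRoots l)
    {c N : ℕ} (hN : c < N) {f : Laurent l} (hf : f ∈ monoSpan fun β => height β ≤ c) :
    evalHom kWeight ((∏ p ∈ S, (1 - mono (root p) ^ N)) * f) = evalHom kWeight f := by
  have hroot : ∀ p ∈ positiveRoots l, height (N • root p) ≤ -N := by
    intro p hp
    have := height_root_neg hp
    have h2 : height (N • root p) = N * height (root p) := by
      simp only [height, Pi.smul_apply, Finset.mul_sum, nsmul_eq_mul]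
      exact Finset.sum_congr rfl fun _ _ => by ring
    rw [h2]
    nlinarith [(Nat.cast_nonneg N : (0 : ℤ) ≤ N)]
  have hvan : ∀ p ∈ positiveRoots l, ∀ g ∈ monoSpan (l := l) (fun β => height β ≤ c),
      evalHom kWeight (mono (root p) ^ N * g) = 0 := by
    intro p hp g hg
    have h1 : mono (root p) ^ N * g ∈ monoSpan (l := l) (fun β => height β < 0) := by
      rw [← mono_nsmul]
      exact mono_mul_mem (fun γ hγ => by rw [height_add]; have := hroot p hp; omega) hg
    exact (Submodule.mem_bot ℤ).1
      (evalHom_mem (fun γ hγ => (Submodule.mem_bot ℤ).2 (kWeight_of_height_neg hγ)) h1)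
  induction S using Finset.cons_induction generalizing f with
  | empty => simp
  | cons p S hp ih =>
    have hpR : p ∈ positiveRoots l := hS (Finset.mem_cons_self p S)
    rw [Finset.prod_cons, mul_right_comm, mul_assoc, mul_comm f, mul_left_comm,
      ih (fun q hq => hS (Finset.mem_cons_of_mem hq)), sub_mul, one_mul, map_sub, hvan p hpR f hf,
      sub_zero]
    rw [sub_mul, one_mul]
    refine sub_mem hf ?_
    rw [← mono_nsmul]
    exact mono_mul_mem (fun γ hγ => by rw [height_add]; have := hroot p hpR; omega) hf

theorem prod_one_sub_pow_eq (Ψ : Finset (Fin l × Fin l)) (N : ℕ) :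
    ∏ p : Ψ, (1 - mono (root p.1) ^ N) = (∏ p : Ψ, (1 - mono (root p.1))) *
      ∑ n ∈ Fintype.piFinset fun _ : Ψ => Finset.range N, mono (∑ p : Ψ, n p • root p.1) := by
  simp_rw [mono_sum, mono_nsmul]
  rw [← Finset.prod_univ_sum, ← Finset.prod_mul_distrib]
  exact Finset.prod_congr rfl fun p _ => (mul_neg_geom_sum _ _).symm

/-- The geometric series `∏_Ψ (1 - R_{ij})⁻¹` cancel the factors of `g_γ = ∏_{Δ⁺} (1 - R_{ij}) k_γ`
that belong to `Ψ`. -/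
theorem finsum_evalHom_gWeight {Ψ : Finset (Fin l × Fin l)} (hΨ : Ψ ⊆ positiveRoots l)
    (f : Laurent l)
    (hfin : (Function.support fun n : Ψ → ℕ =>
      evalHom gWeight (mono (∑ p : Ψ, n p • root p.1) * f)).Finite) :
    ∑ᶠ n : Ψ → ℕ, evalHom gWeight (mono (∑ p : Ψ, n p • root p.1) * f) =
      evalHom kWeight ((∏ p ∈ positiveRoots l \ Ψ, (1 - mono (root p))) * f) := by
  obtain ⟨c, hc⟩ := exists_height_le ((∏ p ∈ positiveRoots l \ Ψ, (1 - mono (root p))) * f)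
  -- Truncated at `N`, the series leave the factors `1 - R_{ij}^N`, which act trivially for `N > c`.
  obtain ⟨N, hcN, hN⟩ : ∃ N : ℕ, c < N ∧ ∀ n ∈ hfin.toFinset, ∀ p, n p < N := by
    refine ⟨(hfin.toFinset.sup fun n => Finset.univ.sup n) + (c + 1), by omega, fun n hn p => ?_⟩
    have := (Finset.le_sup (f := n) (Finset.mem_univ p)).trans
      (Finset.le_sup (f := fun n : Ψ → ℕ => Finset.univ.sup n) hn)
    omega
  have hsub : (Function.support fun n : Ψ → ℕ =>
      evalHom gWeight (mono (∑ p : Ψ, n p • root p.1) * f)) ⊆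
      ((Fintype.piFinset fun _ : Ψ => Finset.range N : Finset (Ψ → ℕ)) : Set (Ψ → ℕ)) := by
    intro n hn
    rw [Finset.mem_coe, Fintype.mem_piFinset]
    exact fun p => Finset.mem_range.2 (hN n (hfin.mem_toFinset.2 hn) p)
  have hV : (∏ p ∈ positiveRoots l, (1 - mono (root p))) =
      (∏ p : Ψ, (1 - mono (root p.1))) * ∏ p ∈ positiveRoots l \ Ψ, (1 - mono (root p)) := by
    rw [Finset.prod_coe_sort Ψ fun p => 1 - mono (root p), mul_comm, Finset.prod_sdiff hΨ]
  rw [finsum_eq_sum_of_support_subset _ hsub, ← map_sum, ← Finset.sum_mul, evalHom_gWeight, hV,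
    ← evalHom_prod_one_sub_pow hΨ hcN hc, ← Finset.prod_coe_sort Ψ fun p => 1 - mono (root p) ^ N,
    prod_one_sub_pow_eq]
  refine congrArg (evalHom kWeight) ?_
  generalize (∏ p : Ψ, (1 - mono (root p.1))) = a
  generalize (∏ p ∈ positiveRoots l \ Ψ, (1 - mono (root p))) = b
  generalize
    (∑ n ∈ Fintype.piFinset fun _ : Ψ => Finset.range N, mono (∑ p : Ψ, n p • root p.1)) = c
  rw [mul_assoc, mul_assoc, mul_left_comm b]

/-- `K(Ψ; M; γ) = ∏_M (1 - L_j) ∏_{Δ⁺ ∖ Ψ} (1 - R_{ij}) k_γ`. -/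
theorem katalan_eq {Ψ : Finset (Fin l × Fin l)} (hΨ : Ψ ⊆ positiveRoots l)
    (M : Multiset (Fin l)) (γ : Fin l → ℤ) :
    katalan Ψ M γ = evalHom kWeight ((M.map fun j => 1 - mono (-Pi.single j 1)).prod *
      ((∏ p ∈ positiveRoots l \ Ψ, (1 - mono (root p))) * mono γ)) := by
  have hfin := katalan_support_finite hΨ M γ
  rw [katalan]
  simp only [mul_assoc] at hfin ⊢
  refine (finsum_evalHom_gWeight hΨ _ hfin).trans ?_
  rw [mul_left_comm]

/-! ### Triangularity of the `k`-Schur functions -/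

variable {k : ℕ}

/-- `∑ μ_i²`. On partitions of a fixed size it is strictly monotone for the dominance order. -/
def sqSum (μ : YoungDiagram) : ℕ := ((parts μ).map (· ^ 2)).sum

theorem sqSum_le (μ : YoungDiagram) : sqSum μ ≤ μ.card ^ 2 := by
  rw [sqSum, card_eq_sum_parts]
  induction parts μ using Multiset.induction_on with
  | empty => simp
  | cons a w ih =>
    simp only [Multiset.map_cons, Multiset.sum_cons]
    nlinarith [Nat.zero_le (a * w.sum)]

theorem cast_sqSum (μ : YoungDiagram) :
    (sqSum μ : ℤ) = ((parts μ).map fun x : ℕ => (x : ℤ) ^ 2).sum := by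
  rw [sqSum, ← Nat.coe_castAddMonoidHom, map_multiset_sum, Multiset.map_map]
  simp

theorem prod_one_sub_root_mul_mono (S : Finset (Fin l × Fin l)) (γ : Fin l → ℤ) :
    (∏ p ∈ S, (1 - mono (root p))) * mono γ - mono γ ∈
      monoSpan fun β => ∃ T ⊆ S, T.Nonempty ∧ β = ∑ p ∈ T, root p + γ := by
  induction S using Finset.cons_induction with
  | empty => simp
  | cons p S hp ih =>
    set X := (∏ p ∈ S, (1 - mono (root p))) * mono γ with hX
    have h1 : (∏ q ∈ Finset.cons p S hp, (1 - mono (root q))) * mono γ - mono γ =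
        (X - mono γ) - mono (root p) * (X - mono γ) - mono (root p + γ) := by
      rw [Finset.prod_cons, mul_assoc, ← hX, mono_add]
      ring
    rw [h1]
    refine sub_mem (sub_mem (monoSpan_mono ?_ ih) (mono_mul_mem ?_ ih)) (mono_mem ?_)
    · rintro β ⟨T, hT, hne, rfl⟩
      exact ⟨T, hT.trans (Finset.subset_cons hp), hne, rfl⟩
    · rintro β ⟨T, hT, hne, rfl⟩
      have hpT : p ∉ T := fun h => hp (hT h)
      exact ⟨Finset.cons p T hpT, Finset.cons_subset_cons.2 hT, Finset.cons_nonempty hpT,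
        by rw [Finset.sum_cons, add_assoc]⟩
    · exact ⟨{p}, by simp, by simp, by simp⟩

theorem sum_sum_root (T : Finset (Fin l × Fin l)) : ∑ i, (∑ p ∈ T, root p) i = 0 := by
  simp_rw [Finset.sum_apply]
  rw [Finset.sum_comm]
  exact Finset.sum_eq_zero fun p _ => by simp [root, Finset.sum_sub_distrib]

theorem sum_mul_root (γ : Fin l → ℤ) (p : Fin l × Fin l) :
    ∑ i, γ i * root p i = γ p.1 - γ p.2 := by
  simp [root, mul_sub, Finset.sum_sub_distrib, Pi.single_apply]

/-- The roots `(i, j)` outside `Δ^k(γ)` have `i < j ≤ i + (k - γ_i)`, so row `i` can be raised at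
most `k - γ_i` times. -/
theorem sum_roots_add_le {γ : Fin l → ℤ} (hγ : ∀ i, γ i ≤ k) {T : Finset (Fin l × Fin l)}
    (hT : T ⊆ positiveRoots l \ kRootIdeal k γ) (i : Fin l) :
    (∑ p ∈ T, root p + γ) i ≤ k := by
  have h1 : (∑ p ∈ T, root p) i ≤ ((T.filter fun p => p.1 = i).card : ℤ) := by
    rw [Finset.sum_apply, Finset.card_filter, Nat.cast_sum]
    refine Finset.sum_le_sum fun p _ => ?_
    simp only [root, Pi.sub_apply, Pi.single_apply]
    split_ifs <;> simp_all
  have h2 : (T.filter fun p => p.1 = i).card ≤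
      (Finset.Ioc (i : ℕ) (i + ((k : ℤ) - γ i).toNat)).card := by
    refine Finset.card_le_card_of_injOn (fun p => (p.2 : ℕ)) ?_ ?_
    · intro p hp
      obtain ⟨hpT, rfl⟩ := Finset.mem_filter.1 hp
      have h3 := hT hpT
      simp only [positiveRoots, kRootIdeal, Finset.mem_sdiff, Finset.mem_filter,
        Finset.mem_univ, true_and, not_and, not_lt] at h3
      have h4 : (p.1 : ℕ) < p.2 := h3.1
      have h5 := h3.2 h3.1
      have := hγ p.1
      simp only [Finset.coe_Ioc, Set.mem_Ioc]
      omega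
    · rintro ⟨a, b⟩ hp ⟨a', b'⟩ hp' hb
      have ha := (Finset.mem_filter.1 hp).2
      have ha' := (Finset.mem_filter.1 hp').2
      simp only at ha ha' hb
      rw [ha, ha', Fin.ext hb]
  rw [Nat.card_Ioc, Nat.add_sub_cancel_left] at h2
  have := hγ i
  rw [Pi.add_apply]
  omega

/-- For `β` a nonempty sum of positive roots, `|γ + β|² = |γ|² + 2⟨γ, β⟩ + |β|²` with `⟨γ, β⟩ ≥ 0`
as `γ` is antitone, and `β ≠ 0` as its height is negative. -/
theorem sum_sq_lt {γ : Fin l → ℤ} (hγ : Antitone γ) {T : Finset (Fin l × Fin l)}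
    (hT : T ⊆ positiveRoots l) (hne : T.Nonempty) :
    ∑ i, γ i ^ 2 < ∑ i, (∑ p ∈ T, root p + γ) i ^ 2 := by
  set β : Fin l → ℤ := ∑ p ∈ T, root p with hβ
  have h1 : ∑ i, (β + γ) i ^ 2 = ∑ i, β i ^ 2 + 2 * ∑ i, γ i * β i + ∑ i, γ i ^ 2 := by
    rw [Finset.mul_sum, ← Finset.sum_add_distrib, ← Finset.sum_add_distrib]
    exact Finset.sum_congr rfl fun i _ => by rw [Pi.add_apply]; ring
  have h2 : 0 ≤ ∑ i, γ i * β i := by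
    simp_rw [hβ, Finset.sum_apply, Finset.mul_sum]
    rw [Finset.sum_comm]
    refine Finset.sum_nonneg fun p hp => ?_
    rw [sum_mul_root]
    have : p.1 < p.2 := by simpa [positiveRoots] using hT hp
    exact sub_nonneg.2 (hγ this.le)
  have h3 : 0 < ∑ i, β i ^ 2 := by
    refine (Finset.sum_nonneg fun i _ => sq_nonneg (β i)).lt_of_ne' fun h0 => ?_
    rw [Finset.sum_eq_zero_iff_of_nonneg fun i _ => sq_nonneg (β i)] at h0
    have h4 : height β = ∑ p ∈ T, height (root p) :=
      map_sum (AddMonoidHom.mk' height height_add) _ _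
    have h5 : ∑ p ∈ T, height (root p) < 0 :=
      Finset.sum_neg (fun p hp => by have := height_root_neg (hT hp); omega) hne
    rw [← h4, height, Finset.sum_eq_zero] at h5
    · exact lt_irrefl _ h5
    · intro i _
      rw [pow_eq_zero_iff two_ne_zero |>.1 (h0 i (Finset.mem_univ i)), mul_zero]
  omega

theorem catalan_eq (Ψ : Finset (Fin l × Fin l)) (γ : Fin l → ℤ) :
    catalan Ψ γ = evalHom hWeight ((∏ p ∈ positiveRoots l \ Ψ, (1 - mono (root p))) * mono γ) :=
  rfl

theorem weight_le (μ : BoundedPartition k) (i : Fin l) : weight μ.1 l i ≤ k := by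
  exact Nat.cast_le.2 ((μ.1.rowLen_anti 0 i (Nat.zero_le _)).trans μ.2)

theorem weight_antitone (μ : YoungDiagram) : Antitone (weight μ l) := fun i j hij =>
  Nat.cast_le.2 (μ.rowLen_anti i j hij)

theorem sum_weight_eq_card {μ : YoungDiagram} (hl : μ.colLen 0 ≤ l) :
    ∑ i, weight μ l i = μ.card := by
  rw [card_eq_sum_parts, ← Nat.coe_castAddMonoidHom, map_multiset_sum]
  exact sum_weight id rfl hl

theorem sum_sq_weight {μ : YoungDiagram} (hl : μ.colLen 0 ≤ l) :
    ∑ i, weight μ l i ^ 2 = sqSum μ := by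
  rw [cast_sqSum]
  exact sum_weight (· ^ 2) (by simp) hl

/-- If all entries of `β` are at most `k`, then `h_β` is `0` or `h_μ` for a `k`-bounded partition
`μ` with the sum and the sum of squares of `β`. -/
theorem hWeight_mem {P : BoundedPartition k → Prop} {β : Fin l → ℤ} (hk : ∀ i, β i ≤ k)
    (hP : ∀ μ : BoundedPartition k, (μ.1.card : ℤ) = ∑ i, β i →
      (sqSum μ.1 : ℤ) = ∑ i, β i ^ 2 → P μ) :
    hWeight β ∈ Submodule.span ℤ (hPartition '' {μ | P μ}) := by
  by_cases h0 : ∀ i, 0 ≤ β i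
  · obtain ⟨μ, h1, h2, h3⟩ := exists_hPartition_eq h0 hk
    exact Submodule.subset_span ⟨μ, hP μ h2 ((cast_sqSum _).trans h3), h1⟩
  · push Not at h0
    obtain ⟨i, hi⟩ := h0
    rw [hWeight, Finset.prod_eq_zero (Finset.mem_univ i) (h_of_neg hi)]
    exact zero_mem _

/-- Every subscript in the expansion of `s^{(k)}_μ` other than `μ` is `μ` plus a nonempty sum of
roots outside `Δ^k(μ)`. -/
theorem kSchur_sub_hPartition_mem (μ : BoundedPartition k) (hl : μ.1.colLen 0 ≤ l) :
    kSchur k (weight μ.1 l) - hPartition μ ∈ Submodule.span ℤ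
      (hPartition '' {ν : BoundedPartition k | ν.1.card = μ.1.card ∧ sqSum μ.1 < sqSum ν.1}) := by
  rw [kSchur, catalan_eq, ← hWeight_weight μ hl, ← evalHom_mono hWeight (weight μ.1 l), ← map_sub]
  refine evalHom_mem ?_ (prod_one_sub_root_mul_mono _ _)
  rintro β ⟨T, hT, hne, rfl⟩
  refine hWeight_mem (sum_roots_add_le (weight_le μ) hT) fun ν h1 h2 => ⟨?_, ?_⟩
  · simp only [Pi.add_apply, Finset.sum_add_distrib, sum_sum_root, zero_add,
      sum_weight_eq_card hl] at h1
    exact_mod_cast h1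
  · have := sum_sq_lt (weight_antitone μ.1) (hT.trans Finset.sdiff_subset) hne
    rw [← h2, sum_sq_weight hl] at this
    exact_mod_cast this

/-! ### Lower degree terms of the `k`-Schur Katalan functions -/

/-- The span of the `h_μ` with `μ ∈ Par^k` and `|μ| ≤ n`. -/
def degreeLE (k : ℕ) (n : ℤ) : Submodule ℤ Series :=
  Submodule.span ℤ (hPartition '' {μ : BoundedPartition k | (μ.1.card : ℤ) ≤ n})

theorem degreeLE_mono {m n : ℤ} (h : m ≤ n) : degreeLE k m ≤ degreeLE k n :=
  Submodule.span_mono (Set.image_mono fun _ h' => le_trans h' h)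

theorem mul_mem_degreeLE {m n : ℤ} {x y : Series} (hx : x ∈ degreeLE k m)
    (hy : y ∈ degreeLE k n) : x * y ∈ degreeLE k (m + n) := by
  induction hx, hy using Submodule.span_induction₂ with
  | mem_mem x y hx hy =>
    obtain ⟨μ, hμ, rfl⟩ := hx
    obtain ⟨ν, hν, rfl⟩ := hy
    obtain ⟨ρ, hρ⟩ := exists_parts_eq (k := k) (w := parts μ.1 + parts ν.1) (by
      intro x hx
      rcases Multiset.mem_add.1 hx with hx | hx
      exacts [⟨pos_of_mem_parts hx, le_of_mem_parts μ hx⟩,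
        ⟨pos_of_mem_parts hx, le_of_mem_parts ν hx⟩])
    refine Submodule.subset_span ⟨ρ, ?_, ?_⟩
    · have h1 : (μ.1.card : ℤ) ≤ m := hμ
      have h2 : (ν.1.card : ℤ) ≤ n := hν
      show (ρ.1.card : ℤ) ≤ m + n
      have : ρ.1.card = μ.1.card + ν.1.card := by
        simp only [card_eq_sum_parts, hρ, Multiset.sum_add]
      omega
    · rw [hPartition, hρ, Multiset.map_add, Multiset.prod_add]
      rfl
  | zero_left y hy => rw [zero_mul]; exact zero_mem _
  | zero_right x hx => rw [mul_zero]; exact zero_mem _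
  | add_left x y z _ _ _ h1 h2 => rw [add_mul]; exact add_mem h1 h2
  | add_right x y z _ _ _ h1 h2 => rw [mul_add]; exact add_mem h1 h2
  | smul_left r x y _ _ h => rw [smul_mul_assoc]; exact Submodule.smul_mem _ _ h
  | smul_right r x y _ _ h => rw [mul_smul_comm]; exact Submodule.smul_mem _ _ h

theorem hWeight_mem_degreeLE {β : Fin l → ℤ} (hk : ∀ i, β i ≤ k) :
    hWeight β ∈ degreeLE k (∑ i, β i) :=
  hWeight_mem hk fun _ h _ => h.le

theorem h_mem_degreeLE {m : ℤ} (hm : m ≤ k) : h m ∈ degreeLE k m := by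
  simpa [hWeight] using hWeight_mem_degreeLE (l := 1) (β := fun _ => m) fun _ => hm

/-- The term `i = 0` of `k_m^{(r)}` is `h_m`, and the other terms have lower degree. -/
theorem kInhom_sub_h_mem (r : ℤ) {m : ℤ} (hm : m ≤ k) :
    kInhom r m - h m ∈ degreeLE k (m - 1) := by
  rcases lt_or_ge m 0 with h0 | h0
  · rw [kInhom_of_neg r h0, h_of_neg h0, sub_zero]
    exact zero_mem _
  · have h1 : (m + 1).toNat = m.toNat + 1 := by omega
    rw [kInhom, h1, Finset.sum_range_succ']
    simp only [Nat.cast_zero, Ring.choose_zero_right, one_smul, sub_zero, add_sub_cancel_right]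
    refine Submodule.sum_mem _ fun i _ => Submodule.smul_mem _ _ ?_
    refine degreeLE_mono ?_ (h_mem_degreeLE (k := k) ?_) <;> push_cast <;> omega

theorem kWeight_sub_hWeight_mem {β : Fin l → ℤ} (hk : ∀ i, β i ≤ k) :
    kWeight β - hWeight β ∈ degreeLE k (∑ i, β i - 1) := by
  suffices ∀ s : Finset (Fin l), (∏ i ∈ s, h (β i)) ∈ degreeLE k (∑ i ∈ s, β i) ∧
      ∏ i ∈ s, kInhom ((i : ℕ) : ℤ) (β i) - ∏ i ∈ s, h (β i) ∈
        degreeLE k (∑ i ∈ s, β i - 1) from (this Finset.univ).2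
  intro s
  induction s using Finset.cons_induction with
  | empty =>
    refine ⟨?_, by simp⟩
    simpa [h_zero] using h_mem_degreeLE (k := k) (m := 0) (by positivity)
  | cons a s ha ih =>
    obtain ⟨h1, h2⟩ := ih
    have h3 := h_mem_degreeLE (hk a)
    have h4 := kInhom_sub_h_mem ((a : ℕ) : ℤ) (hk a)
    have h5 := add_mem (degreeLE_mono (by omega) h2) h1
    rw [sub_add_cancel] at h5
    simp only [Finset.prod_cons, Finset.sum_cons]
    refine ⟨mul_mem_degreeLE h3 h1, ?_⟩
    have h6 := add_mem (degreeLE_mono (n := β a + ∑ i ∈ s, β i - 1) (by omega)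
      (mul_mem_degreeLE h4 h5)) (degreeLE_mono (by omega) (mul_mem_degreeLE h3 h2))
    convert h6 using 1
    ring

theorem kWeight_mem_degreeLE {β : Fin l → ℤ} (hk : ∀ i, β i ≤ k) :
    kWeight β ∈ degreeLE k (∑ i, β i) := by
  have := add_mem (degreeLE_mono (by omega) (kWeight_sub_hWeight_mem hk)) (hWeight_mem_degreeLE hk)
  rwa [sub_add_cancel] at this

theorem evalHom_sub (F G : (Fin l → ℤ) → Series) (f : Laurent l) :
    evalHom F f - evalHom G f = evalHom (F - G) f := by
  have : evalHom F - evalHom G = evalHom (F - G) := by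
    refine LinearMap.ext_on_range span_mono fun γ => ?_
    rw [LinearMap.sub_apply, evalHom_mono, evalHom_mono, evalHom_mono, Pi.sub_apply]
  rw [← this, LinearMap.sub_apply]

theorem prod_one_sub_lowering_mul_sub_mem (M : Multiset (Fin l)) {n : ℤ} {f : Laurent l}
    (hf : f ∈ monoSpan fun β => (∀ i, β i ≤ k) ∧ ∑ i, β i ≤ n) :
    (M.map fun j => 1 - mono (-Pi.single j 1)).prod * f - f ∈
      monoSpan fun β => (∀ i, β i ≤ k) ∧ ∑ i, β i ≤ n - 1 := by
  induction M using Multiset.induction_on with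
  | empty => simp
  | cons j M ih =>
    set A := (M.map fun j => 1 - mono (-Pi.single j (1 : ℤ))).prod with hA
    have h1 : A * f ∈ monoSpan fun β => (∀ i, β i ≤ k) ∧ ∑ i, β i ≤ n := by
      have := add_mem (monoSpan_mono (fun γ h => ⟨h.1, by have := h.2; omega⟩) ih) hf
      rwa [sub_add_cancel] at this
    have h2 : ((j ::ₘ M).map fun j => 1 - mono (-Pi.single j (1 : ℤ))).prod * f - f =
        (A * f - f) - mono (-Pi.single j 1) * (A * f) := by
      rw [Multiset.map_cons, Multiset.prod_cons]
      ring
    rw [h2]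
    refine sub_mem ih (mono_mul_mem (fun γ hγ => ⟨fun i => ?_, ?_⟩) h1)
    · have h3 := hγ.1 i
      have h4 : (0 : ℤ) ≤ Pi.single (M := fun _ : Fin l => ℤ) j 1 i := by
        rw [Pi.single_apply]; split_ifs <;> simp
      rw [Pi.add_apply, Pi.neg_apply]
      omega
    · have h3 := hγ.2
      simp only [Pi.add_apply, Pi.neg_apply, Finset.sum_add_distrib, Finset.sum_neg_distrib,
        Finset.sum_pi_single', Finset.mem_univ, if_true]
      omega

theorem kSchurKatalan_sub_kSchur_mem (μ : BoundedPartition k) (hl : μ.1.colLen 0 ≤ l) :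
    kSchurKatalan k (weight μ.1 l) - kSchur k (weight μ.1 l) ∈ degreeLE k (μ.1.card - 1) := by
  have hΨ : kRootIdeal k (weight μ.1 l) ⊆ positiveRoots l := Finset.filter_subset _ _
  rw [kSchurKatalan, katalan_eq hΨ, kSchur, catalan_eq]
  set X := (∏ p ∈ positiveRoots l \ kRootIdeal k (weight μ.1 l), (1 - mono (root p))) *
    mono (weight μ.1 l) with hX
  set A := ((columnMultiset (kRootIdeal (k + 1) (weight μ.1 l))).map
    fun j => 1 - mono (-Pi.single j (1 : ℤ))).prod with hA
  have hXmem : X ∈ monoSpan fun β => (∀ i, β i ≤ k) ∧ ∑ i, β i ≤ (μ.1.card : ℤ) := by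
    have h1 := prod_one_sub_root_mul_mono (positiveRoots l \ kRootIdeal k (weight μ.1 l))
      (weight μ.1 l)
    rw [← sub_add_cancel X (mono (weight μ.1 l))]
    refine add_mem (monoSpan_mono ?_ h1) (mono_mem ⟨weight_le μ, (sum_weight_eq_card hl).le⟩)
    rintro β ⟨T, hT, -, rfl⟩
    refine ⟨sum_roots_add_le (weight_le μ) hT, ?_⟩
    simp only [Pi.add_apply, Finset.sum_add_distrib, sum_sum_root, zero_add,
      sum_weight_eq_card hl, le_refl]
  have h1 : evalHom kWeight (A * X - X) ∈ degreeLE k (μ.1.card - 1) :=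
    evalHom_mem (fun β hβ => degreeLE_mono hβ.2 (kWeight_mem_degreeLE hβ.1))
      (prod_one_sub_lowering_mul_sub_mem _ hXmem)
  have h2 : evalHom (kWeight - hWeight) X ∈ degreeLE k (μ.1.card - 1) :=
    evalHom_mem (fun β hβ => degreeLE_mono (by have := hβ.2; omega)
      (kWeight_sub_hWeight_mem hβ.1)) hXmem
  rw [← evalHom_sub] at h2
  rw [map_sub] at h1
  have := add_mem h1 h2
  rwa [sub_add_sub_cancel] at this

end Katalan
end

theorem proposition5p12 (k : ℕ) (hk : 0 < k) (len : Katalan.BoundedPartition k → ℕ)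
    (hlen : ∀ μ : Katalan.BoundedPartition k, μ.1.colLen 0 ≤ len μ) :
    (∃ b : Module.Basis (Katalan.BoundedPartition k) ℤ (Katalan.lambdaSub k),
      ∀ μ, (b μ : Katalan.Series) = Katalan.kSchurKatalan k (Katalan.weight μ.1 (len μ))) ∧
    (∃ b : Module.Basis (Katalan.BoundedPartition k) ℤ (Katalan.lambdaSub k),
      ∀ μ, (b μ : Katalan.Series) = Katalan.kSchur k (Katalan.weight μ.1 (len μ))) ∧
    ∀ μ : Katalan.BoundedPartition k, ∃ a : Katalan.BoundedPartition k →₀ ℤ,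
      (∀ ν, a ν ≠ 0 → ν.1.card < μ.1.card) ∧
      Katalan.kSchurKatalan k (Katalan.weight μ.1 (len μ)) =
        Katalan.kSchur k (Katalan.weight μ.1 (len μ)) +
          a.sum fun ν c => c • Katalan.kSchur k (Katalan.weight ν.1 (len ν)) := by
  -- The subtraction in the rank does not truncate: `∑ μ_i² ≤ |μ|²`.
  refine Katalan.exists_bases_of_unitriangular
    (Katalan.linearIndependent_hPartition k) (Katalan.mem_span_hPartition k)
    (fun μ => μ.1.card) (fun μ => μ.1.card ^ 2 - Katalan.sqSum μ.1) (fun μ => ?_) (fun μ => ?_)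
  · refine Submodule.span_mono (Set.image_mono ?_) (Katalan.kSchur_sub_hPartition_mem μ (hlen μ))
    rintro ν ⟨h1, h2⟩
    refine ⟨h1, ?_⟩
    have h3 := Katalan.sqSum_le ν.1
    rw [h1] at h3
    show ν.1.card ^ 2 - Katalan.sqSum ν.1 < μ.1.card ^ 2 - Katalan.sqSum μ.1
    rw [h1]
    omega
  · refine Submodule.span_mono (Set.image_mono fun ν hν => ?_)
      (Katalan.kSchurKatalan_sub_kSchur_mem μ (hlen μ))
    have h1 : (ν.1.card : ℤ) ≤ μ.1.card - 1 := hν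
    show ν.1.card < μ.1.card
    omega
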